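/- A skew (left) brace is a set $B$ with two group structures $(B,+)$ and $(B,\cdot)$, neither assumed commutative, such that $a(b+c)=ab-a+ac$ for all $a,b,c\in B$; the two identity elements then coincide and are denoted by $0$. For $a\in B$ let $\lambda_a\in\operatorname{Aut}(B,+)$ be given by $\lambda_a(b)=-a+ab$. An ideal of $B$ is a subset that is a normal subgroup of both $(B,+)$ and $(B,\cdot)$ and is mapped into itself by every $\lambda_b$, $b\in B$. The cosets $b+I=bI$ of an ideal $I$ form a skew brace $B/I$. The socle of $B$ is the ideal $\operatorname{Soc}(B)=\operatorname{Ker}\lambda\cap Z(B,+)$, where $Z(B,+)$ is the centre of $(B,+)$. Put $\operatorname{Soc}_0(B)=\{0\}$ and let $\operatorname{Soc}_{n+1}(B)$ be the ideal of $B$ with $\operatorname{Soc}_{n+1}(B)/\operatorname{Soc}_n(B)=\operatorname{Soc}\big(B/\operatorname{Soc}_n(B)\big)$ for every integer $n\ge 0$; $B$ has finite multipermutational level if $B=\operatorname{Soc}_n(B)$ for some integer $n\ge 0$. Finally, $B$ is supersoluble if it has a finite chain of ideals $\{0\}=I_0\leq I_1\leq\cdots\leq I_n=B$ such that, for all $0\le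 i<n$, either $(I_{i+1}/I_i,+)$ is infinite cyclic and $I_{i+1}/I_i\leq\operatorname{Soc}(B/I_i)$, or $I_{i+1}/I_i$ has prime order. **Theorem.** Let $B$ be a supersoluble skew brace. Then $(B,+)$ is nilpotent if and only if there is an integer $n\ge 0$ such that $B=\operatorname{Soc}_n(B)$, that is, if and only if $B$ has finite multipermutational level. -/

import Mathlib

/-- A skew left brace: a set with two group structures `(B, +)` and `(B, *)`, the additive one not
necessarily commutative, such that `a * (b + c) = a * b - a + a * c`. -/
class SkewBrace (B : Type*) extends AddGroup B, Group B where
  mul_add_eq : ∀ a b c : B, a * (b + c) = a * b + -a + a * c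

namespace SkewBrace

section Basic

variable {B : Type*} [SkewBrace B]

/-- The two identity elements of a skew brace coincide. -/
theorem one_eq_zero : (1 : B) = 0 := by
  have h := mul_add_eq (1 : B) 0 0
  simpa using h

theorem mul_zero_eq (a : B) : a * 0 = a := by
  rw [← one_eq_zero, mul_one]

/-- The additive automorphism `λ_a : b ↦ -a + a * b`. -/
def lambda (a : B) : B ≃+ B where
  toFun b := -a + a * b
  invFun b := a⁻¹ * (a + b)
  left_inv b := by simp
  right_inv b := by simp
  map_add' b c := by
    rw [mul_add_eq]
    simp only [add_assoc]

theorem lambda_apply (a b : B) : lambda a b = -a + a * b := rfl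

theorem mul_eq_add_lambda (a b : B) : a * b = a + lambda a b := by
  rw [lambda_apply, add_neg_cancel_left a]

theorem lambda_one (b : B) : lambda 1 b = b := by
  rw [lambda_apply, one_mul, one_eq_zero, neg_zero, zero_add]

/-- `λ` is a homomorphism from `(B, *)` to the automorphism group of `(B, +)`. -/
theorem lambda_mul (a c b : B) : lambda (a * c) b = lambda a (lambda c b) := by
  apply add_left_cancel (a := a * c)
  rw [← mul_eq_add_lambda, mul_assoc, mul_eq_add_lambda a (c * b), mul_eq_add_lambda c b, map_add,
    ← add_assoc, ← mul_eq_add_lambda]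

theorem lambda_inv_apply_self (a b : B) : lambda a⁻¹ (lambda a b) = b := by
  rw [← lambda_mul, inv_mul_cancel, lambda_one]

/-- The kernel of `λ`. -/
def lambdaKer (B : Type*) [SkewBrace B] : Subgroup B where
  carrier := {a | ∀ b : B, lambda a b = b}
  one_mem' := lambda_one
  mul_mem' := fun {a c} ha hc b => by rw [lambda_mul, hc b, ha b]
  inv_mem' := fun {a} ha b => by
    have h := lambda_inv_apply_self a b
    rwa [ha b] at h

theorem conj_mem_lambdaKer {a : B} (ha : a ∈ lambdaKer B) (b : B) : b * a * b⁻¹ ∈ lambdaKer B := by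
  intro c
  rw [lambda_mul, lambda_mul, ha, ← lambda_mul, mul_inv_cancel, lambda_one]

end Basic

/-- An ideal of a skew brace `B`: a subset that is a normal subgroup of `(B, +)` and of `(B, *)`
and is invariant under every `λ_b`. -/
structure BraceIdeal (B : Type*) [SkewBrace B] extends AddSubgroup B, Subgroup B where
  lambda_mem' : ∀ (b : B) {a : B}, a ∈ carrier → lambda b a ∈ carrier
  add_conj_mem' : ∀ (b : B) {a : B}, a ∈ carrier → b + a + -b ∈ carrier
  mul_conj_mem' : ∀ (b : B) {a : B}, a ∈ carrier → b * a * b⁻¹ ∈ carrier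

namespace BraceIdeal

variable {B : Type*} [SkewBrace B]

instance : SetLike (BraceIdeal B) B where
  coe I := I.carrier
  coe_injective I J h := by
    obtain ⟨⟨⟨⟨_, _⟩, _⟩, _⟩, _, _, _, _, _⟩ := I
    obtain ⟨⟨⟨⟨_, _⟩, _⟩, _⟩, _, _, _, _, _⟩ := J
    cases h
    rfl

/-- Ideals are ordered by inclusion. -/
instance : PartialOrder (BraceIdeal B) := .ofSetLike (BraceIdeal B) B

instance (I : BraceIdeal B) : I.toAddSubgroup.Normal :=
  ⟨fun _ ha b => I.add_conj_mem' b ha⟩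

/-- The zero ideal. -/
instance : Bot (BraceIdeal B) where
  bot :=
    { (⊥ : AddSubgroup B) with
      carrier := {0}
      mul_mem' := by
        rintro _ _ rfl rfl
        exact mul_zero_eq _
      one_mem' := one_eq_zero
      inv_mem' := by
        rintro _ rfl
        rw [← one_eq_zero]
        exact inv_one
      lambda_mem' := by
        rintro b _ rfl
        exact map_zero _
      add_conj_mem' := by
        rintro b _ rfl
        simp
      mul_conj_mem' := by
        rintro b _ rfl
        simp [mul_zero_eq, one_eq_zero] }

/-- The whole skew brace as an ideal. -/
instance : Top (BraceIdeal B) where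
  top :=
    { (⊤ : AddSubgroup B) with
      carrier := Set.univ
      mul_mem' := fun _ _ => trivial
      one_mem' := trivial
      inv_mem' := fun _ => trivial
      lambda_mem' := fun _ _ _ => trivial
      add_conj_mem' := fun _ _ _ => trivial
      mul_conj_mem' := fun _ _ _ => trivial }

/-- The left cosets `a + I` and `a * I` agree. -/
theorem neg_add_mem_iff (I : BraceIdeal B) (a b : B) :
    -a + b ∈ I.carrier ↔ a⁻¹ * b ∈ I.carrier := by
  have key : lambda a (a⁻¹ * b) = -a + b := by simp [lambda_apply]
  constructor
  · intro h
    have h1 := I.lambda_mem' a⁻¹ h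
    rwa [← key, lambda_inv_apply_self] at h1
  · intro h
    rw [← key]
    exact I.lambda_mem' a h

/-- The underlying set of the quotient skew brace `B / I`: the set of cosets `a + I = a * I`. -/
def Quotient (I : BraceIdeal B) : Type _ := B ⧸ I.toAddSubgroup

/-- The canonical projection `B → B / I`. -/
def proj (I : BraceIdeal B) (a : B) : I.Quotient := QuotientAddGroup.mk a

theorem proj_surjective (I : BraceIdeal B) : Function.Surjective I.proj :=
  QuotientAddGroup.mk_surjective

theorem proj_eq_proj_iff (I : BraceIdeal B) {a b : B} : I.proj a = I.proj b ↔ -a + b ∈ I.carrier :=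
  QuotientAddGroup.eq

instance (I : BraceIdeal B) : AddGroup I.Quotient :=
  inferInstanceAs (AddGroup (B ⧸ I.toAddSubgroup))

/-- Multiplication of cosets: `(a + I) * (b + I) = a * b + I`. -/
instance (I : BraceIdeal B) : Mul I.Quotient where
  mul := Quotient.map₂ (fun a b : B => a * b) (by
    intro a a' ha b b' hb
    have ha' := (I.neg_add_mem_iff a a').1 (QuotientAddGroup.leftRel_apply.1 ha)
    have hb' := (I.neg_add_mem_iff b b').1 (QuotientAddGroup.leftRel_apply.1 hb)
    refine QuotientAddGroup.leftRel_apply.2 ((I.neg_add_mem_iff (a * b) (a' * b')).2 ?_)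
    have h1 := I.mul_mem' (I.mul_conj_mem' b⁻¹ ha') hb'
    have h2 : b⁻¹ * (a⁻¹ * a') * b⁻¹⁻¹ * (b⁻¹ * b') = (a * b)⁻¹ * (a' * b') := by group
    rwa [h2] at h1)

instance (I : BraceIdeal B) : One I.Quotient := ⟨I.proj 1⟩

/-- Inversion of cosets: `(a + I)⁻¹ = a⁻¹ + I`. -/
instance (I : BraceIdeal B) : Inv I.Quotient where
  inv := Quotient.map (fun a : B => a⁻¹) (by
    intro a a' ha
    have ha' := (I.neg_add_mem_iff a a').1 (QuotientAddGroup.leftRel_apply.1 ha)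
    refine QuotientAddGroup.leftRel_apply.2 ((I.neg_add_mem_iff a⁻¹ a'⁻¹).2 ?_)
    have h1 := I.mul_conj_mem' a (I.inv_mem' ha')
    have h2 : a * (a⁻¹ * a')⁻¹ * a⁻¹ = a⁻¹⁻¹ * a'⁻¹ := by group
    rwa [h2] at h1)

theorem proj_add (I : BraceIdeal B) (a b : B) : I.proj (a + b) = I.proj a + I.proj b := rfl
theorem proj_neg (I : BraceIdeal B) (a : B) : I.proj (-a) = -I.proj a := rfl
theorem proj_zero (I : BraceIdeal B) : I.proj 0 = 0 := rfl
theorem proj_mul (I : BraceIdeal B) (a b : B) : I.proj (a * b) = I.proj a * I.proj b := rfl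
theorem proj_inv (I : BraceIdeal B) (a : B) : I.proj a⁻¹ = (I.proj a)⁻¹ := rfl
theorem proj_one (I : BraceIdeal B) : I.proj 1 = 1 := rfl

/-- The quotient of a skew brace by an ideal is a skew brace. -/
instance (I : BraceIdeal B) : SkewBrace I.Quotient :=
  { (inferInstance : AddGroup I.Quotient),
    Group.ofLeftAxioms (G := I.Quotient)
      (by
        intro x y z
        obtain ⟨a, rfl⟩ := I.proj_surjective x
        obtain ⟨b, rfl⟩ := I.proj_surjective y
        obtain ⟨c, rfl⟩ := I.proj_surjective z
        simp only [← proj_mul, mul_assoc])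
      (by
        intro x
        obtain ⟨a, rfl⟩ := I.proj_surjective x
        simp only [← proj_one, ← proj_mul, one_mul])
      (by
        intro x
        obtain ⟨a, rfl⟩ := I.proj_surjective x
        simp only [← proj_one, ← proj_mul, ← proj_inv, inv_mul_cancel]) with
    mul_add_eq := by
      intro x y z
      obtain ⟨a, rfl⟩ := I.proj_surjective x
      obtain ⟨b, rfl⟩ := I.proj_surjective y
      obtain ⟨c, rfl⟩ := I.proj_surjective z
      exact congrArg I.proj (mul_add_eq a b c) }

theorem proj_lambda (I : BraceIdeal B) (a b : B) :
    I.proj (lambda a b) = lambda (I.proj a) (I.proj b) := rfl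

/-- The preimage in `B` of an ideal of `B / I`. -/
def preimage (I : BraceIdeal B) (J : BraceIdeal I.Quotient) : BraceIdeal B where
  carrier := {a | I.proj a ∈ J.carrier}
  add_mem' := fun ha hb => J.add_mem' ha hb
  zero_mem' := J.zero_mem'
  neg_mem' := fun ha => J.neg_mem' ha
  mul_mem' := fun ha hb => J.mul_mem' ha hb
  one_mem' := J.one_mem'
  inv_mem' := fun ha => J.inv_mem' ha
  lambda_mem' := fun b _ ha => J.lambda_mem' (I.proj b) ha
  add_conj_mem' := fun b _ ha => J.add_conj_mem' (I.proj b) ha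
  mul_conj_mem' := fun b _ ha => J.mul_conj_mem' (I.proj b) ha

/-- For `I ≤ J`, the factor `J / I`, as an additive subgroup of `B / I`. -/
def factor (I J : BraceIdeal B) : AddSubgroup I.Quotient where
  carrier := I.proj '' J.carrier
  add_mem' := by
    rintro _ _ ⟨a, ha, rfl⟩ ⟨b, hb, rfl⟩
    exact ⟨a + b, J.add_mem' ha hb, rfl⟩
  zero_mem' := ⟨0, J.zero_mem', rfl⟩
  neg_mem' := by
    rintro _ ⟨a, ha, rfl⟩
    exact ⟨-a, J.neg_mem' ha, rfl⟩

end BraceIdeal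

section Socle

variable {B : Type*} [SkewBrace B]

theorem mul_eq_add_of_mem_ker {a : B} (ha : a ∈ lambdaKer B) (b : B) : a * b = a + b := by
  rw [mul_eq_add_lambda, ha b]

theorem neg_eq_inv_of_mem_ker {a : B} (ha : a ∈ lambdaKer B) : -a = a⁻¹ := by
  have h := mul_eq_add_of_mem_ker ha a⁻¹
  rw [mul_inv_cancel, one_eq_zero] at h
  exact neg_eq_of_add_eq_zero_right h.symm

theorem lambda_mem_center {a : B} (ha : a ∈ AddSubgroup.center B) (b : B) :
    lambda b a ∈ AddSubgroup.center B := by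
  rw [AddSubgroup.mem_center_iff] at ha ⊢
  intro c
  obtain ⟨d, rfl⟩ := (lambda b).surjective c
  rw [← map_add, ha d, map_add]

theorem conj_eq_lambda {a : B} (ha : a ∈ lambdaKer B) (hc : a ∈ AddSubgroup.center B) (b : B) :
    b * a * b⁻¹ = lambda b a := by
  have h1 := AddSubgroup.mem_center_iff.1 (lambda_mem_center hc b) b
  rw [mul_assoc, mul_eq_add_of_mem_ker ha, mul_add_eq, mul_inv_cancel, one_eq_zero, add_zero,
    mul_eq_add_lambda b a, h1, add_neg_cancel_right]

/-- The socle `Soc(B) = Ker λ ∩ Z(B, +)`, an ideal of `B`. -/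
def socle (B : Type*) [SkewBrace B] : BraceIdeal B where
  carrier := {a | a ∈ lambdaKer B ∧ a ∈ AddSubgroup.center B}
  add_mem' := fun {a b} ha hb =>
    ⟨mul_eq_add_of_mem_ker ha.1 b ▸ mul_mem ha.1 hb.1, add_mem ha.2 hb.2⟩
  zero_mem' := ⟨one_eq_zero (B := B) ▸ one_mem _, zero_mem _⟩
  neg_mem' := fun {a} ha => ⟨neg_eq_inv_of_mem_ker ha.1 ▸ inv_mem ha.1, neg_mem ha.2⟩
  mul_mem' := fun {a b} ha hb =>
    ⟨mul_mem ha.1 hb.1, (mul_eq_add_of_mem_ker ha.1 b).symm ▸ add_mem ha.2 hb.2⟩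
  one_mem' := ⟨one_mem _, (one_eq_zero (B := B)).symm ▸ zero_mem _⟩
  inv_mem' := fun {a} ha => ⟨inv_mem ha.1, neg_eq_inv_of_mem_ker ha.1 ▸ neg_mem ha.2⟩
  lambda_mem' := fun b {a} ha =>
    ⟨conj_eq_lambda ha.1 ha.2 b ▸ conj_mem_lambdaKer ha.1 b,
      lambda_mem_center ha.2 b⟩
  add_conj_mem' := fun b {a} ha => by
    have h : b + a + -b = a := by
      rw [AddSubgroup.mem_center_iff.1 ha.2 b, add_neg_cancel_right]
    rwa [h]
  mul_conj_mem' := fun b {a} ha =>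
    ⟨conj_mem_lambdaKer ha.1 b,
      (conj_eq_lambda ha.1 ha.2 b).symm ▸ lambda_mem_center ha.2 b⟩

/-- The finite part of the upper socle series: `Soc_0(B) = {0}`, and `Soc_{n+1}(B)` is the ideal
with `Soc_{n+1}(B) / Soc_n(B) = Soc(B / Soc_n(B))`. -/
def socleSeries (B : Type*) [SkewBrace B] : ℕ → BraceIdeal B
  | 0 => ⊥
  | n + 1 => (socleSeries B n).preimage (socle (socleSeries B n).Quotient)

/-- `B` is supersoluble if it has a finite chain of ideals `{0} = I_0 ≤ I_1 ≤ ⋯ ≤ I_n = B` such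
that each factor `I_{i+1} / I_i` either is additively infinite cyclic and contained in
`Soc(B / I_i)`, or has prime order. -/
def IsSupersoluble (B : Type*) [SkewBrace B] : Prop :=
  ∃ (n : ℕ) (I : ℕ → BraceIdeal B), I 0 = ⊥ ∧ I n = ⊤ ∧
    ∀ i < n, I i ≤ I (i + 1) ∧
      ((IsAddCyclic ((I i).factor (I (i + 1))) ∧ Infinite ((I i).factor (I (i + 1))) ∧
          ∀ x ∈ (I i).factor (I (i + 1)), x ∈ socle (I i).Quotient) ∨
        (Nat.card ((I i).factor (I (i + 1)))).Prime)

end Socle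

end SkewBrace

/-!
Suppose `(B, +)` is nilpotent. A factor `F = I_{i+1} / I_i` of prime order is a normal subgroup of
the nilpotent group `(B / I_i, +)`, so it meets the centre nontrivially and is therefore central.
For `a ∈ F` the map `b ↦ -b + λ_a(b)` on `B / I_i` takes values in the ideal `F`; since `F` is
central, the map is additive, so its image is zero or `F`. If it takes the value `-a` at `b`, then
`a * b = b`, and so `a` is trivial. Hence `λ_a` is the identity in either case: all factors of the
chain lie in the socles, and the socle series dominates the chain.

Conversely, the socle series is an ascending central series of `(B, +)`.
-/

section AddGroup

variable {G : Type*} [AddGroup G]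

theorem eq_bot_or_eq_of_le_of_card_prime {H K : AddSubgroup G} (hHK : H ≤ K)
    (hK : (Nat.card K).Prime) : H = ⊥ ∨ H = K := by
  have : Finite K := Nat.finite_of_card_ne_zero hK.ne_zero
  refine ((Nat.dvd_prime hK).1 (AddSubgroup.card_dvd_of_le hHK)).imp H.eq_bot_of_card_eq fun h => ?_
  exact AddSubgroup.eq_of_le_of_card_ge hHK h.ge

theorem eq_bot_of_disjoint_center [AddGroup.IsNilpotent G] {H : AddSubgroup G} [H.Normal]
    (hH : Disjoint H (AddSubgroup.center G)) : H = ⊥ := by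
  have disjoint_upperCentralSeries (n : ℕ) :
      Disjoint H (AddSubgroup.upperCentralSeries G n) := by
    induction n with
    | zero => exact disjoint_bot_right
    | succ n ih =>
      let K := H ⊓ AddSubgroup.upperCentralSeries G (n + 1)
      have commutator_le : ⁅K, (⊤ : AddSubgroup G)⁆ ≤ H ⊓ AddSubgroup.upperCentralSeries G n :=
        le_inf ((AddSubgroup.addCommutator_mono inf_le_left le_rfl).trans
            (AddSubgroup.addCommutator_le_left H ⊤))
          ((AddSubgroup.addCommutator_mono inf_le_right le_rfl).trans
            (AddSubgroup.addCommutator_upperCentralSeries_top_le G n))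
      have le_center : K ≤ AddSubgroup.center G :=
        AddSubgroup.addCommutator_top_right_eq_bot_iff_le_center.1
          (le_bot_iff.1 (commutator_le.trans ih.le_bot))
      exact disjoint_iff_inf_le.2 ((le_inf inf_le_left le_center).trans hH.le_bot)
  obtain ⟨n, hn⟩ := AddGroup.IsNilpotent.nilpotent G
  exact disjoint_top.1 (hn ▸ disjoint_upperCentralSeries n)

theorem le_center_of_card_prime [AddGroup.IsNilpotent G] {H : AddSubgroup G} [H.Normal]
    (hH : (Nat.card H).Prime) : H ≤ AddSubgroup.center G := by
  rcases eq_bot_or_eq_of_le_of_card_prime (inf_le_left : H ⊓ AddSubgroup.center G ≤ H) hH with h | h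
  · exact (eq_bot_of_disjoint_center (disjoint_iff.2 h)).trans_le bot_le
  · exact inf_eq_left.1 h

/-- The displacement `g ↦ -g + φ g` of an additive endomorphism `φ`. The displacements are required
to be central, which makes the map additive. -/
def centralDisplacement (φ : G →+ G) (hφ : ∀ g, -g + φ g ∈ AddSubgroup.center G) : G →+ G :=
  AddMonoidHom.mk' (fun g => -g + φ g) fun g h => by
    have comm : -h + (-g + φ g) = -g + φ g + -h := AddSubgroup.mem_center_iff.1 (hφ g) (-h)
    calc -(g + h) + φ (g + h) = -h + (-g + φ g) + φ h := by
          simp only [map_add, neg_add_rev, add_assoc]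
      _ = -g + φ g + (-h + φ h) := by rw [comm, add_assoc]

end AddGroup

namespace SkewBrace

variable {B : Type*} [SkewBrace B]

theorem mem_socle_iff {a : B} :
    a ∈ socle B ↔ (∀ b, lambda a b = b) ∧ ∀ b, b + a = a + b :=
  and_congr Iff.rfl AddSubgroup.mem_center_iff

theorem add_lambda_eq_add_lambda_conj (a b : B) :
    a + lambda a b = b + lambda b (b⁻¹ * a * b) := by
  rw [← mul_eq_add_lambda, ← mul_eq_add_lambda, mul_assoc, mul_inv_cancel_left]

theorem eq_zero_of_neg_add_lambda_eq_neg {a b : B} (ha : a ∈ AddSubgroup.center B)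
    (h : -b + lambda a b = -a) : a = 0 := by
  have mul_eq : a * b = b := by
    rw [mul_eq_add_lambda, eq_add_of_neg_add_eq h, ← add_assoc,
      ← AddSubgroup.mem_center_iff.1 ha b, add_neg_cancel_right]
  exact (mul_eq_right.1 mul_eq).trans one_eq_zero

theorem le_socle_of_card_prime {F : AddSubgroup B} (hF : (Nat.card F).Prime)
    (hF_center : F ≤ AddSubgroup.center B) (hF_lambda : ∀ a ∈ F, ∀ b, -b + lambda a b ∈ F) :
    F ≤ (socle B).toAddSubgroup := by
  intro a ha
  let δ := centralDisplacement (lambda a).toAddMonoidHom fun b => hF_center (hF_lambda a ha b)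
  have range_le : δ.range ≤ F := by
    rintro _ ⟨b, rfl⟩
    exact hF_lambda a ha b
  refine ⟨fun b => ?_, hF_center ha⟩
  rcases eq_bot_or_eq_of_le_of_card_prime range_le hF with h | h
  · have displacement_eq_zero : -b + lambda a b = 0 :=
      DFunLike.congr_fun (AddMonoidHom.range_eq_bot_iff.1 h) b
    exact (neg_add_eq_zero.1 displacement_eq_zero).symm
  · obtain ⟨c, hc⟩ : -a ∈ δ.range := h ▸ neg_mem ha
    rw [eq_zero_of_neg_add_lambda_eq_neg (hF_center ha) hc, ← one_eq_zero, lambda_one]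

namespace BraceIdeal

theorem neg_add_lambda_mem (J : BraceIdeal B) {a : B} (ha : a ∈ J) (b : B) :
    -b + lambda a b ∈ J := by
  have conj_mem := J.mul_conj_mem' b⁻¹ ha
  have neg_conj_mem := J.add_conj_mem' (-b) (J.neg_mem' ha)
  rw [inv_inv] at conj_mem
  rw [neg_neg] at neg_conj_mem
  have eq_add : -b + lambda a b = -b + -a + b + lambda b (b⁻¹ * a * b) := by
    rw [add_assoc _ b, ← add_lambda_eq_add_lambda_conj, add_assoc, neg_add_cancel_left]
  rw [eq_add]
  exact J.add_mem' neg_conj_mem (J.lambda_mem' b conj_mem)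

theorem neg_add_lambda_mem_factor {I J : BraceIdeal B} {x : I.Quotient} (hx : x ∈ I.factor J)
    (y : I.Quotient) : -y + lambda x y ∈ I.factor J := by
  obtain ⟨a, ha, rfl⟩ := hx
  obtain ⟨b, rfl⟩ := I.proj_surjective y
  exact ⟨-b + lambda a b, J.neg_add_lambda_mem ha b, rfl⟩

instance factor_normal (I J : BraceIdeal B) : (I.factor J).Normal where
  conj_mem := by
    rintro _ ⟨a, ha, rfl⟩ y
    obtain ⟨b, rfl⟩ := I.proj_surjective y
    exact ⟨b + a + -b, J.add_conj_mem' b ha, rfl⟩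

instance isNilpotent_quotient (I : BraceIdeal B) [AddGroup.IsNilpotent B] :
    AddGroup.IsNilpotent I.Quotient :=
  inferInstanceAs (AddGroup.IsNilpotent (B ⧸ I.toAddSubgroup))

theorem factor_le_socle_of_card_prime [AddGroup.IsNilpotent B] {I J : BraceIdeal B}
    (h : (Nat.card (I.factor J)).Prime) : I.factor J ≤ (socle I.Quotient).toAddSubgroup :=
  le_socle_of_card_prime h (le_center_of_card_prime h) fun _ => neg_add_lambda_mem_factor

theorem proj_mem_socle_iff (I : BraceIdeal B) {a : B} :
    I.proj a ∈ socle I.Quotient ↔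
      (∀ b, -b + lambda a b ∈ I) ∧ ∀ b, -(b + a) + (a + b) ∈ I := by
  rw [mem_socle_iff, I.proj_surjective.forall, I.proj_surjective.forall]
  refine and_congr (forall_congr' fun b => ?_) (forall_congr' fun b => ?_)
  · rw [← proj_lambda, eq_comm, proj_eq_proj_iff]
    rfl
  · rw [← proj_add, ← proj_add, proj_eq_proj_iff]
    rfl

theorem le_preimage_socle {I J K : BraceIdeal B} (hIK : I ≤ K)
    (hJ : I.factor J ≤ (socle I.Quotient).toAddSubgroup) : J ≤ K.preimage (socle K.Quotient) := by
  intro a ha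
  obtain ⟨lambda_mem, comm_mem⟩ := I.proj_mem_socle_iff.1 (hJ ⟨a, ha, rfl⟩)
  exact K.proj_mem_socle_iff.2 ⟨fun b => hIK (lambda_mem b), fun b => hIK (comm_mem b)⟩

end BraceIdeal

theorem le_socleSeries {n : ℕ} {I : ℕ → BraceIdeal B} (h0 : I 0 = ⊥)
    (hI : ∀ i < n, (I i).factor (I (i + 1)) ≤ (socle (I i).Quotient).toAddSubgroup) :
    I n ≤ socleSeries B n := by
  induction n with
  | zero => exact h0.le
  | succ n ih =>
    exact BraceIdeal.le_preimage_socle (ih fun i hi => hI i (hi.trans n.lt_succ_self))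
      (hI n n.lt_succ_self)

theorem isAscendingCentralSeries_socleSeries :
    AddSubgroup.IsAscendingCentralSeries fun n => (socleSeries B n).toAddSubgroup := by
  refine ⟨rfl, fun a n ha b => ?_⟩
  have conj_eq : b + a + (-(b + a) + (a + b)) + -(b + a) = a + b + -a + -b := by
    simp only [neg_add_rev, add_assoc, add_neg_cancel_left]
  have comm_mem := ((socleSeries B n).proj_mem_socle_iff.1 ha).2 b
  have conj_mem := (socleSeries B n).add_conj_mem' (b + a) comm_mem
  rwa [conj_eq] at conj_mem

theorem isNilpotent_of_socleSeries_eq_top {n : ℕ} (h : socleSeries B n = ⊤) :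
    AddGroup.IsNilpotent B :=
  (AddSubgroup.nilpotent_iff_finite_ascending_central_series B).2
    ⟨n, _, isAscendingCentralSeries_socleSeries, congrArg (fun I => I.toAddSubgroup) h⟩

end SkewBrace

open SkewBrace in
theorem theorem3p21_general {B : Type*} [SkewBrace B] {n : ℕ} {I : ℕ → BraceIdeal B}
    (h0 : I 0 = ⊥) (hn : I n = ⊤)
    (hI : ∀ i < n, (I i).factor (I (i + 1)) ≤ (socle (I i).Quotient).toAddSubgroup ∨
      (Nat.card ((I i).factor (I (i + 1)))).Prime) :
    AddGroup.IsNilpotent B ↔ ∃ n : ℕ, socleSeries B n = ⊤ := by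
  refine ⟨fun _ => ⟨n, ?_⟩, fun ⟨_, h⟩ => isNilpotent_of_socleSeries_eq_top h⟩
  have factor_le_socle (i : ℕ) (hi : i < n) :
      (I i).factor (I (i + 1)) ≤ (socle (I i).Quotient).toAddSubgroup :=
    (hI i hi).elim id BraceIdeal.factor_le_socle_of_card_prime
  exact le_antisymm (fun _ _ => trivial) (hn ▸ le_socleSeries h0 factor_le_socle)

/-- A supersoluble skew brace has nilpotent additive group if and only if it has finite
multipermutational level. -/
theorem theorem3p21 {B : Type*} [SkewBrace B] (hB : SkewBrace.IsSupersoluble B) :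
    AddGroup.IsNilpotent B ↔ ∃ n : ℕ, SkewBrace.socleSeries B n = ⊤ := by
  obtain ⟨n, I, h0, hn, hI⟩ := hB
  exact theorem3p21_general h0 hn fun i hi => (hI i hi).2.imp_left fun h => h.2.2
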